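/- **Setting.** Fix countably infinitely many propositional variables $p$. Formulas of the bimodal language $\mathcal L$ are given by $A ::= p \mid \bot \mid A\land A \mid A\lor A \mid A\to A \mid \Box A \mid \Diamond A$; $\mathcal L_\Box$ is the language without $\Diamond$ and $\mathcal L_\Diamond$ the language without $\Box$. Write $\top := \bot\to\bot$ and $\neg A := A\to\bot$. **Logics.** Every logic below is the Hilbert system, in the respective language, that consists of intuitionistic propositional logic (axiom schemes $A\to(B\to A)$; $(A\to(B\to C))\to((A\to B)\to(A\to C))$; $A\land B\to A$; $A\land B\to B$; $A\to(B\to A\land B)$; $A\to A\lor B$; $B\to A\lor B$; $(A\to C)\to((B\to C)\to(A\lor B\to C))$; $\bot\to A$; and modus ponens), of the congruence rule "from $A\to B$ and $B\to A$ infer $\heartsuit A\to\heartsuit B$" for each modal operator $\heartsuit$ of the language, and of some of the following principles: - $M_\Box$: $\Box(A\land B)\to\Box A$; $\;C_\Box$: $\Box A\land\Box B\to\Box(A\land B)$; $\;N_\Box$: $\Box\top$; - $M_\Diamond$: $\Diamond A\to\Diamond(A\lor B)$; $\;N_\Diamond$: $\neg\Diamond\bot$; - weak interaction: the axioms $\neg(\Box\top\land\Diamond\bot)$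 and $\neg(\Diamond\top\land\Box\bot)$; - medium interaction: the axioms $\neg(\Box A\land\Diamond\neg A)$ and $\neg(\Box\neg A\land\Diamond A)$; - strong interaction: the rule "from $\neg(A\land B)$ infer $\neg(\Box A\land\Diamond B)$". The 24 *bimodal logics*, in $\mathcal L$, are obtained by taking one of the four bases - $\mathsf{E}_1$: weak interaction; $\;\mathsf{E}_2$: medium interaction; $\;\mathsf{E}_3$: strong interaction; $\;\mathsf{M}$: $M_\Box$, $M_\Diamond$ and strong interaction, adding or not adding $C_\Box$, and adding none of $N_\Box,N_\Diamond$, or $N_\Diamond$ alone, or $N_\Box$ alone. The eight *monomodal $\Box$-logics*, in $\mathcal L_\Box$, are given by the subsets of $\{M_\Box,C_\Box,N_\Box\}$, and the four *monomodal $\Diamond$-logics*, in $\mathcal L_\Diamond$, by the subsets of $\{M_\Diamond,N_\Diamond\}$. **Models.** A *coupled intuitionistic neighbourhood model* is a tuple $\mathcal M=\langle W,\preceq,\mathcal N_\Box,\mathcal N_\Diamond,V\rangle$, where $W$ is a non-empty set, $\preceq$ is a preorder on $W$, $V$ assigns to each $w\in W$ a set of propositional variables with $V(w)\subseteq V(v)$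 whenever $w\preceq v$, and $\mathcal N_\Box,\mathcal N_\Diamond:W\to\mathcal P(\mathcal P(W))$ are such that $w\preceq v$ implies $\mathcal N_\Box(w)\subseteq \mathcal N_\Box(v)$ and $\mathcal N_\Diamond(w)\supseteq \mathcal N_\Diamond(v)$. Forcing is defined by: $w\Vdash p$ iff $p\in V(w)$; $w\not\Vdash\bot$; $w\Vdash A\land B$ iff $w\Vdash A$ and $w\Vdash B$; $w\Vdash A\lor B$ iff $w\Vdash A$ or $w\Vdash B$; $w\Vdash A\to B$ iff for all $v\succeq w$, $v\Vdash A$ implies $v\Vdash B$; $w\Vdash\Box A$ iff $[A]\in \mathcal N_\Box(w)$; $w\Vdash\Diamond A$ iff $W\setminus[A]\notin \mathcal N_\Diamond(w)$, where $[A]=\{v\in W: v\Vdash A\}$. Models for $\mathcal L_\Box$ (for $\mathcal L_\Diamond$) are defined in the same way with $\mathcal N_\Diamond$ (with $\mathcal N_\Box$) and the clauses about it removed. A neighbourhood function $\mathcal N$ is *supplemented* if $\alpha\in \mathcal N(w)$ and $\alpha\subseteq\beta$ imply $\beta\in \mathcal N(w)$; *closed under intersection* if $\alpha,\beta\in \mathcal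 N(w)$ imply $\alpha\cap\beta\in \mathcal N(w)$; it *contains the unit* if $W\in \mathcal N(w)$ for all $w$. For $\alpha\subseteq W$ let $-\alpha=\{w\in W: \text{for all } v\succeq w,\ v\notin\alpha\}$. The principles correspond to the following conditions: - $M_\Box$: $\mathcal N_\Box$ is supplemented; $C_\Box$: $\mathcal N_\Box$ is closed under intersection; $N_\Box$: the function $\mathcal N_\Box$ contains the unit; - $M_\Diamond$: $\mathcal N_\Diamond$ is supplemented; $N_\Diamond$: the function $\mathcal N_\Diamond$ contains the unit; - weak interaction: $\mathcal N_\Box(w)\subseteq \mathcal N_\Diamond(w)$ for all $w$; - medium interaction: for all $w$ and $\alpha$, $\alpha\in \mathcal N_\Box(w)$ implies $W\setminus -\alpha\in \mathcal N_\Diamond(w)$, and $-\alpha\in \mathcal N_\Box(w)$ implies $W\setminus\alpha\in \mathcal N_\Diamond(w)$; - strong interaction: for all $w$, if $\alpha\in \mathcal N_\Box(w)$ and $\alpha\subseteq\beta$ then $\beta\in \mathcal N_\Diamond(w)$. The models *corresponding* to a logic $L$ are the models for its language that satisfy the conditions corresponding to all the principles in $L$. A formula is *valid* in a class of models if it is forced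 at every world of every model in the class. **Theorem (soundness and completeness).** Let $L$ be any of the 24 bimodal logics, of the eight monomodal $\Box$-logics, or of the four monomodal $\Diamond$-logics. Then for every formula $A$ of the language of $L$: - (soundness) if $A$ is derivable in $L$, then $A$ is valid in the class of models corresponding to $L$; - (completeness) if $A$ is valid in the class of models corresponding to $L$, then $A$ is derivable in $L$. -/

import Mathlib

universe u

namespace INNML

/-- The two modal operators. -/
inductive Modality : Type
  | box
  | diam

/-- Formulas of the propositional modal language whose modal operators are those in `S`, over the
countably many propositional variables `p₀, p₁, …`.  All displayed connectives are primitive. -/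
inductive Formula (S : Set Modality) : Type
  | atom (p : ℕ) : Formula S
  | bot : Formula S
  | and (A B : Formula S) : Formula S
  | or (A B : Formula S) : Formula S
  | imp (A B : Formula S) : Formula S
  | box (hb : Modality.box ∈ S) (A : Formula S) : Formula S
  | diam (hd : Modality.diam ∈ S) (A : Formula S) : Formula S

/-- The bimodal language. -/
abbrev biLang : Set Modality := Set.univ

/-- The language without `◇`. -/
abbrev boxLang : Set Modality := {Modality.box}

/-- The language without `□`. -/
abbrev diamLang : Set Modality := {Modality.diam}

namespace Formula

variable {S : Set Modality}

/-- `⊤` abbreviates `⊥ → ⊥`. -/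
abbrev top : Formula S := imp bot bot

/-- `¬ A` abbreviates `A → ⊥`. -/
abbrev neg (A : Formula S) : Formula S := imp A bot

end Formula

/-- The modal principles (besides the congruence rules) from which the logics are built. -/
inductive Principle : Type
  /-- `□(A ∧ B) → □A` -/
  | mBox
  /-- `□A ∧ □B → □(A ∧ B)` -/
  | cBox
  /-- `□⊤` -/
  | nBox
  /-- `◇A → ◇(A ∨ B)` -/
  | mDiam
  /-- `¬◇⊥` -/
  | nDiam
  /-- the two axioms `¬(□⊤ ∧ ◇⊥)` and `¬(◇⊤ ∧ □⊥)` -/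
  | weakInt
  /-- the two axioms `¬(□A ∧ ◇¬A)` and `¬(□¬A ∧ ◇A)` -/
  | mediumInt
  /-- the rule: from `¬(A ∧ B)` infer `¬(□A ∧ ◇B)` -/
  | strongInt

open Formula in
/-- `Derivable S P A`: the formula `A` is derivable in the Hilbert system in the language with
modal operators `S` given by intuitionistic propositional logic, the congruence rules for the
modal operators in `S`, and the principles in `P`. -/
inductive Derivable (S : Set Modality) (P : Set Principle) : Formula S → Prop
  -- intuitionistic propositional logic
  | imp1 (A B : Formula S) : Derivable S P (imp A (imp B A))
  | imp2 (A B C : Formula S) :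
      Derivable S P (imp (imp A (imp B C)) (imp (imp A B) (imp A C)))
  | and1 (A B : Formula S) : Derivable S P (imp (and A B) A)
  | and2 (A B : Formula S) : Derivable S P (imp (and A B) B)
  | and3 (A B : Formula S) : Derivable S P (imp A (imp B (and A B)))
  | or1 (A B : Formula S) : Derivable S P (imp A (or A B))
  | or2 (A B : Formula S) : Derivable S P (imp B (or A B))
  | or3 (A B C : Formula S) :
      Derivable S P (imp (imp A C) (imp (imp B C) (imp (or A B) C)))
  | efq (A : Formula S) : Derivable S P (imp bot A)
  | mp (A B : Formula S) :
      Derivable S P A → Derivable S P (imp A B) → Derivable S P B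
  -- congruence rules
  | reBox (hb : Modality.box ∈ S) (A B : Formula S) :
      Derivable S P (imp A B) → Derivable S P (imp B A) →
      Derivable S P (imp (box hb A) (box hb B))
  | reDiam (hd : Modality.diam ∈ S) (A B : Formula S) :
      Derivable S P (imp A B) → Derivable S P (imp B A) →
      Derivable S P (imp (diam hd A) (diam hd B))
  -- optional modal axioms
  | mBox (hP : Principle.mBox ∈ P) (hb : Modality.box ∈ S) (A B : Formula S) :
      Derivable S P (imp (box hb (and A B)) (box hb A))
  | cBox (hP : Principle.cBox ∈ P) (hb : Modality.box ∈ S) (A B : Formula S) :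
      Derivable S P (imp (and (box hb A) (box hb B)) (box hb (and A B)))
  | nBox (hP : Principle.nBox ∈ P) (hb : Modality.box ∈ S) :
      Derivable S P (box hb top)
  | mDiam (hP : Principle.mDiam ∈ P) (hd : Modality.diam ∈ S) (A B : Formula S) :
      Derivable S P (imp (diam hd A) (diam hd (or A B)))
  | nDiam (hP : Principle.nDiam ∈ P) (hd : Modality.diam ∈ S) :
      Derivable S P (neg (diam hd bot))
  -- optional interactions
  | weakIntA (hP : Principle.weakInt ∈ P)
      (hb : Modality.box ∈ S) (hd : Modality.diam ∈ S) :
      Derivable S P (neg (and (box hb top) (diam hd bot)))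
  | weakIntB (hP : Principle.weakInt ∈ P)
      (hb : Modality.box ∈ S) (hd : Modality.diam ∈ S) :
      Derivable S P (neg (and (diam hd top) (box hb bot)))
  | mediumIntA (hP : Principle.mediumInt ∈ P)
      (hb : Modality.box ∈ S) (hd : Modality.diam ∈ S) (A : Formula S) :
      Derivable S P (neg (and (box hb A) (diam hd (neg A))))
  | mediumIntB (hP : Principle.mediumInt ∈ P)
      (hb : Modality.box ∈ S) (hd : Modality.diam ∈ S) (A : Formula S) :
      Derivable S P (neg (and (box hb (neg A)) (diam hd A)))
  | strongInt (hP : Principle.strongInt ∈ P)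
      (hb : Modality.box ∈ S) (hd : Modality.diam ∈ S) (A B : Formula S) :
      Derivable S P (neg (and A B)) →
      Derivable S P (neg (and (box hb A) (diam hd B)))

/-! ### The logics -/

/-- The four basic bimodal systems. -/
inductive BiBase : Type
  /-- non-monotonic, weak interaction -/
  | E1
  /-- non-monotonic, medium interaction -/
  | E2
  /-- non-monotonic, strong interaction -/
  | E3
  /-- monotonic -/
  | M

/-- The principles of the four basic bimodal systems. -/
def BiBase.principles : BiBase → Set Principle
  | .E1 => {Principle.weakInt}
  | .E2 => {Principle.mediumInt}
  | .E3 => {Principle.strongInt}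
  | .M => {Principle.mBox, Principle.mDiam, Principle.strongInt}

/-- The optional necessitation-type axiom of a bimodal system: none, `¬◇⊥`, or `□⊤`. -/
inductive BiUnit : Type
  | none
  | nDiam
  | nBox

/-- The principles contributed by the optional necessitation-type axiom. -/
def BiUnit.principles : BiUnit → Set Principle
  | .none => ∅
  | .nDiam => {Principle.nDiam}
  | .nBox => {Principle.nBox}

/-- The 24 bimodal systems: four bases, each with or without the axiom `C` for `□`, and with at
most one of the axioms `¬◇⊥` and `□⊤`. -/
def biPrinciples (b : BiBase) (c : Bool) (n : BiUnit) : Set Principle :=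
  b.principles ∪ {p | c = true ∧ p = Principle.cBox} ∪ n.principles

/-- The eight monomodal `□`-systems: any combination of the axioms `M`, `C`, `N` for `□`. -/
def boxPrinciples (m c n : Bool) : Set Principle :=
  {p | (m = true ∧ p = Principle.mBox) ∨ (c = true ∧ p = Principle.cBox) ∨
    (n = true ∧ p = Principle.nBox)}

/-- The four monomodal `◇`-systems: any combination of the axioms `M`, `N` for `◇`. -/
def diamPrinciples (m n : Bool) : Set Principle :=
  {p | (m = true ∧ p = Principle.mDiam) ∨ (n = true ∧ p = Principle.nDiam)}

/-! ### Coupled intuitionistic neighbourhood models -/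

/-- Coupled intuitionistic neighbourhood models for the language with modal operators `S`: the
neighbourhood function of a modal operator is present exactly when the operator is in `S`. -/
structure Model (S : Set Modality) : Type (u + 1) where
  W : Type u
  nonempty : Nonempty W
  le : W → W → Prop
  le_refl : ∀ w, le w w
  le_trans : ∀ w v x, le w v → le v x → le w x
  nbox : Modality.box ∈ S → W → Set (Set W)
  ndiam : Modality.diam ∈ S → W → Set (Set W)
  val : W → Set ℕ
  val_mono : ∀ w v, le w v → val w ⊆ val v
  nbox_mono : ∀ hb w v, le w v → nbox hb w ⊆ nbox hb v
  ndiam_anti : ∀ hd w v, le w v → ndiam hd v ⊆ ndiam hd w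

namespace Model

variable {S : Set Modality}

/-- `M.Forces A w`: the world `w` forces `A`. -/
def Forces (M : Model.{u} S) : Formula S → M.W → Prop
  | .atom p, w => p ∈ M.val w
  | .bot, _ => False
  | .and A B, w => M.Forces A w ∧ M.Forces B w
  | .or A B, w => M.Forces A w ∨ M.Forces B w
  | .imp A B, w => ∀ v, M.le w v → M.Forces A v → M.Forces B v
  | .box hb A, w => {v | M.Forces A v} ∈ M.nbox hb w
  | .diam hd A, w => {v | M.Forces A v}ᶜ ∉ M.ndiam hd w

/-- The set of worlds no successor of which lies in `α`. -/
def setNeg (M : Model.{u} S) (α : Set M.W) : Set M.W :=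
  {w | ∀ v, M.le w v → v ∉ α}

end Model

/-- `N` is supplemented. -/
def Supplemented {W : Type u} (N : W → Set (Set W)) : Prop :=
  ∀ w, ∀ α β : Set W, α ∈ N w → α ⊆ β → β ∈ N w

/-- `N` is closed under (binary) intersection. -/
def ClosedInter {W : Type u} (N : W → Set (Set W)) : Prop :=
  ∀ w, ∀ α β : Set W, α ∈ N w → β ∈ N w → α ∩ β ∈ N w

/-- `N` contains the unit. -/
def ContainsUnit {W : Type u} (N : W → Set (Set W)) : Prop :=
  ∀ w, (Set.univ : Set W) ∈ N w

namespace Model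

variable {S : Set Modality}

/-- Weak interaction. -/
def WeakInt (M : Model.{u} S) (hb : Modality.box ∈ S) (hd : Modality.diam ∈ S) : Prop :=
  ∀ w, M.nbox hb w ⊆ M.ndiam hd w

/-- Medium interaction (two conditions, always taken together). -/
def MediumInt (M : Model.{u} S) (hb : Modality.box ∈ S) (hd : Modality.diam ∈ S) : Prop :=
  (∀ w, ∀ α : Set M.W, α ∈ M.nbox hb w → (M.setNeg α)ᶜ ∈ M.ndiam hd w) ∧
  (∀ w, ∀ α : Set M.W, M.setNeg α ∈ M.nbox hb w → αᶜ ∈ M.ndiam hd w)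

/-- Strong interaction. -/
def StrongInt (M : Model.{u} S) (hb : Modality.box ∈ S) (hd : Modality.diam ∈ S) : Prop :=
  ∀ w, ∀ α β : Set M.W, α ∈ M.nbox hb w → α ⊆ β → β ∈ M.ndiam hd w

/-- The semantic condition that corresponds to a principle. -/
def SatisfiesPrinciple (M : Model.{u} S) : Principle → Prop
  | .mBox => ∀ hb, Supplemented (M.nbox hb)
  | .cBox => ∀ hb, ClosedInter (M.nbox hb)
  | .nBox => ∀ hb, ContainsUnit (M.nbox hb)
  | .mDiam => ∀ hd, Supplemented (M.ndiam hd)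
  | .nDiam => ∀ hd, ContainsUnit (M.ndiam hd)
  | .weakInt => ∀ hb hd, M.WeakInt hb hd
  | .mediumInt => ∀ hb hd, M.MediumInt hb hd
  | .strongInt => ∀ hb hd, M.StrongInt hb hd

/-- `M` is a model for the system with principles `P`. -/
def IsModelFor (M : Model.{u} S) (P : Set Principle) : Prop :=
  ∀ p ∈ P, M.SatisfiesPrinciple p

end Model

/-- `A` is valid in the class of all models for the system with principles `P`. -/
def Valid (S : Set Modality) (P : Set Principle) (A : Formula S) : Prop :=
  ∀ M : Model.{u} S, M.IsModelFor P → ∀ w : M.W, M.Forces A w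

/-- Soundness of the system in the language `S` with principles `P` for its class of models. -/
def Sound (S : Set Modality) (P : Set Principle) : Prop :=
  ∀ A : Formula S, Derivable S P A → Valid.{u} S P A

/-- Completeness of the system in the language `S` with principles `P` for its class of models. -/
def Complete (S : Set Modality) (P : Set Principle) : Prop :=
  ∀ A : Formula S, Valid.{u} S P A → Derivable S P A

end INNML

namespace INNML

variable {S : Set Modality} {P : Set Principle}

/-! ### Soundness -/

theorem Model.Forces.mono (M : Model.{u} S) {A : Formula S} {w v : M.W} (h : M.le w v)
    (hw : M.Forces A w) : M.Forces A v := by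
  induction A generalizing w v with
  | atom p => exact M.val_mono w v h hw
  | bot => exact hw
  | and A B ihA ihB => exact ⟨ihA h hw.1, ihB h hw.2⟩
  | or A B ihA ihB => exact hw.imp (ihA h) (ihB h)
  | imp A B _ _ => exact fun x hx hA => hw x (M.le_trans _ _ _ h hx) hA
  | box hb A _ => exact M.nbox_mono hb w v h hw
  | diam hd A _ => exact fun h' => hw (M.ndiam_anti hd w v h h')

theorem sound (S : Set Modality) (P : Set Principle) : Sound.{u} S P := by
  intro A hA M hM
  have hext : ∀ A B : Formula S, (∀ w, M.Forces (.imp A B) w) → (∀ w, M.Forces (.imp B A) w) →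
      {v | M.Forces A v} = {v | M.Forces B v} := fun A B h₁ h₂ =>
    Set.ext fun w => ⟨h₁ w w (M.le_refl w), h₂ w w (M.le_refl w)⟩
  induction hA with
  | imp1 A B => exact fun w v _ hA x hx _ => hA.mono M hx
  | imp2 A B C =>
    intro w v _ h₁ x hx h₂ y hy hA
    exact h₁ y (M.le_trans _ _ _ hx hy) hA y (M.le_refl y) (h₂ y hy hA)
  | and1 A B => exact fun w v _ h => h.1
  | and2 A B => exact fun w v _ h => h.2
  | and3 A B => exact fun w v _ hA x hx hB => ⟨hA.mono M hx, hB⟩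
  | or1 A B => exact fun w v _ h => Or.inl h
  | or2 A B => exact fun w v _ h => Or.inr h
  | or3 A B C =>
    intro w v _ h₁ x hx h₂ y hy h
    exact h.elim (h₁ y (M.le_trans _ _ _ hx hy)) (h₂ y hy)
  | efq A => exact fun w v _ h => h.elim
  | mp A B _ _ ih₁ ih₂ => exact fun w => ih₂ w w (M.le_refl w) (ih₁ w)
  | reBox hb A B _ _ ih₁ ih₂ =>
    intro w v _ h
    simp only [Model.Forces] at h ⊢
    rwa [← hext A B ih₁ ih₂]
  | reDiam hd A B _ _ ih₁ ih₂ =>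
    intro w v _ h
    simp only [Model.Forces] at h ⊢
    rwa [← hext A B ih₁ ih₂]
  | mBox hP hb A B => exact fun w v _ h => hM _ hP hb v _ _ h fun x hx => hx.1
  | cBox hP hb A B => exact fun w v _ h => hM _ hP hb v _ _ h.1 h.2
  | nBox hP hb =>
    intro w
    have : {v | M.Forces (.top : Formula S) v} = Set.univ :=
      Set.eq_univ_of_forall fun v x _ h => h
    simp only [Model.Forces] at this ⊢
    rw [this]
    exact hM _ hP hb w
  | mDiam hP hd A B =>
    exact fun w v _ h h' => h (hM _ hP hd v _ _ h' fun x hx hA => hx (Or.inl hA))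
  | nDiam hP hd =>
    intro w v _ h
    apply h
    have : {v | M.Forces (.bot : Formula S) v}ᶜ = Set.univ :=
      Set.eq_univ_of_forall fun v h => h
    rw [this]
    exact hM _ hP hd v
  | weakIntA hP hb hd =>
    intro w v _ h
    refine h.2 ?_
    have : {v | M.Forces (.bot : Formula S) v}ᶜ = {v | M.Forces (.top : Formula S) v} :=
      Set.ext fun v => ⟨fun _ x _ h => h, fun _ h => h⟩
    rw [this]
    exact hM _ hP hb hd v h.1
  | weakIntB hP hb hd =>
    intro w v _ h
    refine h.1 ?_
    have : {v | M.Forces (.top : Formula S) v}ᶜ = {v | M.Forces (.bot : Formula S) v} :=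
      Set.ext fun v => ⟨fun h => h fun x _ h => h, fun h => h.elim⟩
    rw [this]
    exact hM _ hP hb hd v h.2
  | mediumIntA hP hb hd A => exact fun w v _ h => h.2 ((hM _ hP hb hd).1 v _ h.1)
  | mediumIntB hP hb hd A => exact fun w v _ h => h.2 ((hM _ hP hb hd).2 v _ h.1)
  | strongInt hP hb hd A B _ ih =>
    exact fun w v _ h => h.2 (hM _ hP hb hd v _ _ h.1
      fun x hA hB => ih x x (M.le_refl x) ⟨hA, hB⟩)

/-! ### Derived rules -/

namespace Derivable

variable {A B C : Formula S}

theorem modusPonens (h : Derivable S P (.imp A B)) (hA : Derivable S P A) : Derivable S P B :=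
  .mp _ _ hA h

theorem weaken (h : Derivable S P B) : Derivable S P (.imp A B) :=
  (imp1 _ _).modusPonens h

theorem imp_self (A : Formula S) : Derivable S P (.imp A A) :=
  ((imp2 A (.imp A A) A).modusPonens (imp1 _ _)).modusPonens (imp1 _ _)

theorem imp_trans (h₁ : Derivable S P (.imp A B)) (h₂ : Derivable S P (.imp B C)) :
    Derivable S P (.imp A C) :=
  ((imp2 _ _ _).modusPonens h₂.weaken).modusPonens h₁

theorem imp_and (h₁ : Derivable S P (.imp A B)) (h₂ : Derivable S P (.imp A C)) :
    Derivable S P (.imp A (.and B C)) :=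
  ((imp2 _ _ _).modusPonens (h₁.imp_trans (and3 B C))).modusPonens h₂

theorem or_imp (h₁ : Derivable S P (.imp A C)) (h₂ : Derivable S P (.imp B C)) :
    Derivable S P (.imp (.or A B) C) :=
  ((or3 _ _ _).modusPonens h₁).modusPonens h₂

theorem box_mono (hP : Principle.mBox ∈ P) (hb : Modality.box ∈ S)
    (h : Derivable S P (.imp A B)) : Derivable S P (.imp (.box hb A) (.box hb B)) :=
  (reBox hb A (.and B A) (h.imp_and (imp_self A)) (and2 _ _)).imp_trans (mBox hP hb B A)

theorem diam_mono (hP : Principle.mDiam ∈ P) (hd : Modality.diam ∈ S)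
    (h : Derivable S P (.imp A B)) : Derivable S P (.imp (.diam hd A) (.diam hd B)) :=
  (mDiam hP hd A B).imp_trans (reDiam hd (.or A B) B (h.or_imp (imp_self B)) (or2 _ _))

end Derivable

/-! ### The disjunction property -/

/-- The Kleene slash. -/
def Slash (P : Set Principle) : Formula S → Prop
  | .atom p => Derivable S P (.atom p)
  | .bot => Derivable S P .bot
  | .and A B => Slash P A ∧ Slash P B
  | .or A B => Slash P A ∨ Slash P B
  | .imp A B => Derivable S P (.imp A B) ∧ (Slash P A → Slash P B)
  | .box hb A => Derivable S P (.box hb A)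
  | .diam hd A => Derivable S P (.diam hd A)

theorem Slash.derivable {A : Formula S} (h : Slash P A) : Derivable S P A := by
  induction A with
  | atom p => exact h
  | bot => exact h
  | and A B ihA ihB => exact ((Derivable.and3 A B).modusPonens (ihA h.1)).modusPonens (ihB h.2)
  | or A B ihA ihB =>
    exact h.elim (fun h => (Derivable.or1 A B).modusPonens (ihA h))
      fun h => (Derivable.or2 A B).modusPonens (ihB h)
  | imp A B _ _ => exact h.1
  | box hb A _ => exact h
  | diam hd A _ => exact h

theorem Derivable.slash (hcon : ¬ Derivable S P .bot) {A : Formula S} (h : Derivable S P A) :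
    Slash P A := by
  induction h with
  | imp1 A B => exact ⟨imp1 A B, fun hA => ⟨hA.derivable.weaken, fun _ => hA⟩⟩
  | imp2 A B C =>
    exact ⟨imp2 A B C, fun h₁ => ⟨(imp2 A B C).modusPonens h₁.1, fun h₂ =>
      ⟨((imp2 A B C).modusPonens h₁.1).modusPonens h₂.1, fun hA => (h₁.2 hA).2 (h₂.2 hA)⟩⟩⟩
  | and1 A B => exact ⟨and1 A B, fun h => h.1⟩
  | and2 A B => exact ⟨and2 A B, fun h => h.2⟩
  | and3 A B =>
    exact ⟨and3 A B, fun hA => ⟨(and3 A B).modusPonens hA.derivable, fun hB => ⟨hA, hB⟩⟩⟩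
  | or1 A B => exact ⟨or1 A B, Or.inl⟩
  | or2 A B => exact ⟨or2 A B, Or.inr⟩
  | or3 A B C =>
    exact ⟨or3 A B C, fun h₁ => ⟨(or3 A B C).modusPonens h₁.1, fun h₂ =>
      ⟨h₁.1.or_imp h₂.1, fun h => h.elim h₁.2 h₂.2⟩⟩⟩
  | efq A => exact ⟨efq A, fun h => (hcon h).elim⟩
  | mp A B _ _ ih₁ ih₂ => exact ih₂.2 ih₁
  | reBox hb A B h₁ h₂ => exact ⟨reBox hb A B h₁ h₂, (reBox hb A B h₁ h₂).modusPonens⟩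
  | reDiam hd A B h₁ h₂ => exact ⟨reDiam hd A B h₁ h₂, (reDiam hd A B h₁ h₂).modusPonens⟩
  | mBox hP hb A B => exact ⟨mBox hP hb A B, (mBox hP hb A B).modusPonens⟩
  | cBox hP hb A B =>
    exact ⟨cBox hP hb A B, fun h => (cBox hP hb A B).modusPonens h.derivable⟩
  | nBox hP hb => exact nBox hP hb
  | mDiam hP hd A B => exact ⟨mDiam hP hd A B, (mDiam hP hd A B).modusPonens⟩
  | nDiam hP hd => exact ⟨nDiam hP hd, (nDiam hP hd).modusPonens⟩
  | weakIntA hP hb hd =>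
    exact ⟨weakIntA hP hb hd, fun h => (weakIntA hP hb hd).modusPonens h.derivable⟩
  | weakIntB hP hb hd =>
    exact ⟨weakIntB hP hb hd, fun h => (weakIntB hP hb hd).modusPonens h.derivable⟩
  | mediumIntA hP hb hd A =>
    exact ⟨mediumIntA hP hb hd A, fun h => (mediumIntA hP hb hd A).modusPonens h.derivable⟩
  | mediumIntB hP hb hd A =>
    exact ⟨mediumIntB hP hb hd A, fun h => (mediumIntB hP hb hd A).modusPonens h.derivable⟩
  | strongInt hP hb hd A B h =>
    exact ⟨strongInt hP hb hd A B h,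
      fun h' => (strongInt hP hb hd A B h).modusPonens h'.derivable⟩

theorem Derivable.disjunction (hcon : ¬ Derivable S P .bot) {A B : Formula S}
    (h : Derivable S P (.or A B)) : Derivable S P A ∨ Derivable S P B :=
  (h.slash hcon).imp Slash.derivable Slash.derivable

/-! ### Theories -/

/-- Sets of formulas that contain all theorems and are closed under modus ponens. -/
structure IsTheory (P : Set Principle) (T : Set (Formula S)) : Prop where
  of_derivable : ∀ {A}, Derivable S P A → A ∈ T
  mp : ∀ {A B}, Formula.imp A B ∈ T → A ∈ T → B ∈ T

/-- Consistent theories with the disjunction property. -/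
structure IsPrimeTheory (P : Set Principle) (T : Set (Formula S)) : Prop extends
    IsTheory P T where
  bot_notMem : Formula.bot ∉ T
  prime : ∀ {A B}, Formula.or A B ∈ T → A ∈ T ∨ B ∈ T

/-- The theory generated by `T` and `A`. -/
def adjoin (T : Set (Formula S)) (A : Formula S) : Set (Formula S) :=
  {B | Formula.imp A B ∈ T}

theorem isTheory_derivable : IsTheory P {A : Formula S | Derivable S P A} :=
  ⟨id, fun h hA => h.modusPonens hA⟩

namespace IsTheory

variable {T : Set (Formula S)} {A B : Formula S}

theorem mem_of_derivable (hT : IsTheory P T) (h : Derivable S P (.imp A B)) (hA : A ∈ T) :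
    B ∈ T :=
  hT.mp (hT.of_derivable h) hA

theorem and_mem_iff (hT : IsTheory P T) : Formula.and A B ∈ T ↔ A ∈ T ∧ B ∈ T :=
  ⟨fun h => ⟨hT.mem_of_derivable (.and1 A B) h, hT.mem_of_derivable (.and2 A B) h⟩,
    fun h => hT.mp (hT.mem_of_derivable (.and3 A B) h.1) h.2⟩

theorem adjoin (hT : IsTheory P T) (A : Formula S) : IsTheory P (adjoin T A) where
  of_derivable h := hT.of_derivable h.weaken
  mp h hA := hT.mp (hT.mem_of_derivable (.imp2 _ _ _) h) hA

theorem subset_adjoin (hT : IsTheory P T) (A : Formula S) : T ⊆ INNML.adjoin T A :=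
  fun _ h => hT.mem_of_derivable (.imp1 _ _) h

theorem mem_adjoin_self (hT : IsTheory P T) (A : Formula S) : A ∈ INNML.adjoin T A :=
  hT.of_derivable (.imp_self A)

/-- The prime theory lemma. -/
theorem exists_prime (hT : IsTheory P T) (hA : A ∉ T) :
    ∃ X, IsPrimeTheory P X ∧ T ⊆ X ∧ A ∉ X := by
  obtain ⟨X, hTX, hX⟩ := zorn_subset_nonempty {X | IsTheory P X ∧ A ∉ X} (by
    intro c hc hchain ⟨Y, hY⟩
    refine ⟨⋃₀ c, ⟨⟨fun h => ⟨Y, hY, (hc hY).1.of_derivable h⟩, ?_⟩, ?_⟩,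
      fun Z hZ => Set.subset_sUnion_of_mem hZ⟩
    · rintro B C ⟨Z₁, hZ₁, h₁⟩ ⟨Z₂, hZ₂, h₂⟩
      rcases hchain.total hZ₁ hZ₂ with h | h
      · exact ⟨Z₂, hZ₂, (hc hZ₂).1.mp (h h₁) h₂⟩
      · exact ⟨Z₁, hZ₁, (hc hZ₁).1.mp h₁ (h h₂)⟩
    · rintro ⟨Z, hZ, h⟩
      exact (hc hZ).2 h) T ⟨hT, hA⟩
  have hXt : IsTheory P X := hX.prop.1
  have key : ∀ B, B ∉ X → Formula.imp B A ∈ X := by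
    intro B hB
    by_contra h
    exact hB (hX.le_of_ge (y := INNML.adjoin X B) ⟨hXt.adjoin B, h⟩ (hXt.subset_adjoin B)
      (hXt.mem_adjoin_self B))
  refine ⟨X, ⟨hXt, fun h => hX.prop.2 (hXt.mem_of_derivable (.efq A) h), ?_⟩, hTX, hX.prop.2⟩
  intro B C h
  by_contra! hBC
  exact hX.prop.2
    (hXt.mp (hXt.mp (hXt.mem_of_derivable (.or3 B C A) (key B hBC.1)) (key C hBC.2)) h)

end IsTheory

/-! ### The canonical model -/

variable (S P) in
/-- The worlds of the canonical model. -/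
abbrev World : Type u := ULift.{u} {X : Set (Formula S) // IsPrimeTheory P X}

namespace World

/-- The formulas that belong to a world. -/
def theory (w : World.{u} S P) : Set (Formula S) := w.down.1

theorem isPrimeTheory (w : World.{u} S P) : IsPrimeTheory P w.theory := w.down.2

theorem isTheory (w : World.{u} S P) : IsTheory P w.theory := w.isPrimeTheory.toIsTheory

end World

variable (P) in
/-- The worlds that contain `A`. -/
def ext (A : Formula S) : Set (World.{u} S P) := {w | A ∈ w.theory}

theorem IsTheory.exists_world {T : Set (Formula S)} {A : Formula S} (hT : IsTheory P T)
    (hA : A ∉ T) : ∃ w : World.{u} S P, T ⊆ w.theory ∧ A ∉ w.theory :=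
  let ⟨X, hX, h⟩ := hT.exists_prime hA
  ⟨⟨X, hX⟩, h⟩

theorem imp_mem_theory_iff {A B : Formula S} {w : World.{u} S P} :
    Formula.imp A B ∈ w.theory ↔
      ∀ v : World.{u} S P, w.theory ⊆ v.theory → A ∈ v.theory → B ∈ v.theory := by
  refine ⟨fun h v hv hA => v.isTheory.mp (hv h) hA, fun h => ?_⟩
  by_contra hAB
  obtain ⟨v, hv, hB⟩ := (w.isTheory.adjoin A).exists_world (A := B) hAB
  exact hB (h v ((w.isTheory.subset_adjoin A).trans hv) (hv (w.isTheory.mem_adjoin_self A)))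

theorem derivable_of_forall_mem {A : Formula S} (h : ∀ w : World.{u} S P, A ∈ w.theory) :
    Derivable S P A := by
  by_contra hA
  obtain ⟨w, -, hw⟩ := isTheory_derivable.exists_world.{u} hA
  exact hw (h w)

theorem derivable_imp_of_ext_subset {A B : Formula S}
    (h : ext.{u} P A ⊆ ext P B) : Derivable S P (.imp A B) :=
  derivable_of_forall_mem fun _ => imp_mem_theory_iff.2 fun _ _ hA => h hA

theorem derivable_neg_and_of_disjoint {A B : Formula S}
    (h : ext.{u} P A ⊆ (ext P B)ᶜ) : Derivable S P (.neg (.and A B)) :=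
  derivable_imp_of_ext_subset.{u} fun w hw =>
    (h (w.isTheory.and_mem_iff.1 hw).1 (w.isTheory.and_mem_iff.1 hw).2).elim

theorem ext_and (A B : Formula S) : ext.{u} P (.and A B) = ext P A ∩ ext P B :=
  Set.ext fun w => w.isTheory.and_mem_iff

theorem ext_bot : ext.{u} P (.bot : Formula S) = ∅ :=
  Set.eq_empty_of_forall_notMem fun w => w.isPrimeTheory.bot_notMem

theorem ext_top : ext.{u} P (.top : Formula S) = Set.univ :=
  Set.eq_univ_of_forall fun w => w.isTheory.of_derivable (.imp_self _)

theorem ext_neg (A : Formula S) :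
    ext.{u} P (.neg A) = {w | ∀ v : World.{u} S P, w.theory ⊆ v.theory → v ∉ ext P A} :=
  Set.ext fun _ => imp_mem_theory_iff.trans
    ⟨fun h v hv hA => v.isPrimeTheory.bot_notMem (h v hv hA), fun h v hv hA => (h v hv hA).elim⟩

theorem box_mem_of_ext_eq {A B : Formula S} {hb : Modality.box ∈ S} {w : World.{u} S P}
    (h : ext.{u} P A = ext P B) (hA : Formula.box hb A ∈ w.theory) :
    Formula.box hb B ∈ w.theory :=
  w.isTheory.mem_of_derivable (.reBox hb A B (derivable_imp_of_ext_subset.{u} h.subset)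
    (derivable_imp_of_ext_subset.{u} h.superset)) hA

theorem diam_mem_of_ext_eq {A B : Formula S} {hd : Modality.diam ∈ S} {w : World.{u} S P}
    (h : ext.{u} P A = ext P B) (hA : Formula.diam hd A ∈ w.theory) :
    Formula.diam hd B ∈ w.theory :=
  w.isTheory.mem_of_derivable (.reDiam hd A B (derivable_imp_of_ext_subset.{u} h.subset)
    (derivable_imp_of_ext_subset.{u} h.superset)) hA

/-- The canonical model; its neighbourhood functions are supplemented when the corresponding
monotonicity axiom is present. -/
def canonicalModel (S : Set Modality) (P : Set Principle) (hne : Nonempty (World.{u} S P)) :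
    Model.{u} S where
  W := World.{u} S P
  nonempty := hne
  le w v := w.theory ⊆ v.theory
  le_refl _ := subset_rfl
  le_trans _ _ _ := Set.Subset.trans
  nbox hb w := {α | ∃ A, Formula.box hb A ∈ w.theory ∧
    (ext P A = α ∨ Principle.mBox ∈ P ∧ ext P A ⊆ α)}
  ndiam hd w := {α | ¬ ∃ A, Formula.diam hd A ∈ w.theory ∧
    (α = (ext P A)ᶜ ∨ Principle.mDiam ∈ P ∧ α ⊆ (ext P A)ᶜ)}
  val w := {p | Formula.atom p ∈ w.theory}
  val_mono _ _ h _ hp := h hp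
  nbox_mono _ _ _ h := fun _ ⟨A, hA, hα⟩ => ⟨A, h hA, hα⟩
  ndiam_anti _ _ _ h := fun _ hα ⟨A, hA, hα'⟩ => hα ⟨A, h hA, hα'⟩

theorem canonicalModel_forces_iff {hne : Nonempty (World.{u} S P)} {A : Formula S}
    {w : World.{u} S P} : (canonicalModel S P hne).Forces A w ↔ A ∈ w.theory := by
  induction A generalizing w with
  | atom p => exact Iff.rfl
  | bot => exact ⟨False.elim, w.isPrimeTheory.bot_notMem⟩
  | and A B ihA ihB => exact (and_congr ihA ihB).trans w.isTheory.and_mem_iff.symm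
  | or A B ihA ihB =>
    refine (or_congr ihA ihB).trans ⟨fun h => h.elim ?_ ?_, w.isPrimeTheory.prime⟩
    · exact w.isTheory.mem_of_derivable (.or1 A B)
    · exact w.isTheory.mem_of_derivable (.or2 A B)
  | imp A B ihA ihB =>
    rw [imp_mem_theory_iff]
    exact forall_congr' fun v => imp_congr Iff.rfl (imp_congr ihA ihB)
  | box hb A ih =>
    have hA : {v | (canonicalModel S P hne).Forces A v} = ext P A := Set.ext fun v => ih
    simp only [Model.Forces, hA]
    refine ⟨?_, fun h => ⟨A, h, Or.inl rfl⟩⟩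
    rintro ⟨B, hB, h | ⟨hP, h⟩⟩
    · exact box_mem_of_ext_eq h hB
    · exact w.isTheory.mem_of_derivable (.box_mono hP hb (derivable_imp_of_ext_subset.{u} h)) hB
  | diam hd A ih =>
    have hA : {v | (canonicalModel S P hne).Forces A v} = ext P A := Set.ext fun v => ih
    simp only [Model.Forces, hA]
    refine ⟨fun h => ?_, fun h h' => h' ⟨A, h, Or.inl rfl⟩⟩
    obtain ⟨B, hB, h | ⟨hP, h⟩⟩ := not_not.1 h
    · exact diam_mem_of_ext_eq (compl_injective h).symm hB
    · exact w.isTheory.mem_of_derivable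
        (.diam_mono hP hd (derivable_imp_of_ext_subset.{u} (Set.compl_subset_compl.1 h))) hB

theorem canonicalModel_setNeg {hne : Nonempty (World.{u} S P)} (A : Formula S) :
    (canonicalModel S P hne).setNeg (ext P A) = ext P (.neg A) :=
  (ext_neg A).symm

/-- The weak and medium interaction principles come without monotonicity axioms. -/
def WeakNonmonotonic (P : Set Principle) : Prop :=
  Principle.weakInt ∈ P ∨ Principle.mediumInt ∈ P → Principle.mBox ∉ P ∧ Principle.mDiam ∉ P

/-- If the extensions of `A` and `B` are complementary, then one of them is empty. -/
theorem ext_eq_univ_or_of_eq_compl (hne : Nonempty (World.{u} S P)) {A B : Formula S}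
    (h : ext.{u} P A = (ext P B)ᶜ) :
    ext.{u} P A = ext P .top ∧ ext.{u} P B = ext P .bot ∨
      ext.{u} P A = ext P .bot ∧ ext.{u} P B = ext P .top := by
  have hcon : ¬ Derivable S P .bot := fun h =>
    hne.elim fun w => w.isPrimeTheory.bot_notMem (w.isTheory.of_derivable h)
  have hAB : Derivable S P (.or A B) := derivable_of_forall_mem.{u} fun w => by
    by_cases hB : w ∈ ext P B
    · exact w.isTheory.mem_of_derivable (.or2 A B) hB
    · exact w.isTheory.mem_of_derivable (.or1 A B) (h.superset hB)
  simp only [ext_top, ext_bot]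
  rcases hAB.disjunction hcon with hA | hB
  · have hA' : ext.{u} P A = Set.univ :=
      Set.eq_univ_of_forall fun w => w.isTheory.of_derivable hA
    exact Or.inl ⟨hA', by rwa [hA', eq_comm, Set.compl_univ_iff] at h⟩
  · have hB' : ext.{u} P B = Set.univ :=
      Set.eq_univ_of_forall fun w => w.isTheory.of_derivable hB
    exact Or.inr ⟨by rwa [hB', Set.compl_univ] at h, hB'⟩

theorem canonicalModel_isModelFor (hP : WeakNonmonotonic P) (hne : Nonempty (World.{u} S P)) :
    (canonicalModel S P hne).IsModelFor P := by
  have contra : ∀ {A B : Formula S} (w : World.{u} S P), Derivable S P (.neg (.and A B)) →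
      A ∈ w.theory → B ∈ w.theory → False := fun w h hA hB =>
    w.isPrimeTheory.bot_notMem
      (w.isTheory.mem_of_derivable h (w.isTheory.and_mem_iff.2 ⟨hA, hB⟩))
  rintro (_ | _ | _ | _ | _ | _ | _ | _) hp
  · rintro hb w α β ⟨A, hA, h⟩ hαβ
    exact ⟨A, hA, Or.inr ⟨hp, h.elim (fun h => h.subset.trans hαβ) fun h => h.2.trans hαβ⟩⟩
  · rintro hb w α β ⟨A, hA, h₁⟩ ⟨B, hB, h₂⟩
    refine ⟨.and A B, w.isTheory.mem_of_derivable (.cBox hp hb A B)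
      (w.isTheory.and_mem_iff.2 ⟨hA, hB⟩), ?_⟩
    rw [ext_and]
    rcases h₁ with rfl | ⟨hm, h₁⟩
    · rcases h₂ with rfl | ⟨hm, h₂⟩
      · exact Or.inl rfl
      · exact Or.inr ⟨hm, Set.inter_subset_inter subset_rfl h₂⟩
    · exact Or.inr ⟨hm, Set.inter_subset_inter h₁ (h₂.elim Eq.subset And.right)⟩
  · intro hb w
    exact ⟨.top, w.isTheory.of_derivable (.nBox hp hb), Or.inl ext_top⟩
  · rintro hd w α β hα hαβ ⟨A, hA, h⟩
    exact hα ⟨A, hA, Or.inr ⟨hp, h.elim (fun h => hαβ.trans h.subset) fun h => hαβ.trans h.2⟩⟩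
  · rintro hd w ⟨A, hA, h⟩
    have h' : ext.{u} P A = ext P .bot := by
      rw [ext_bot, ← Set.compl_univ_iff]
      exact Set.univ_subset_iff.1 (h.elim Eq.subset And.right)
    exact w.isPrimeTheory.bot_notMem
      (w.isTheory.mem_of_derivable (.nDiam hp hd) (diam_mem_of_ext_eq h' hA))
  · rintro hb hd w α ⟨A, hA, h₁⟩ ⟨B, hB, h₂⟩
    have hm := hP (Or.inl hp)
    replace h₁ := h₁.resolve_right fun h => hm.1 h.1
    replace h₂ := h₂.resolve_right fun h => hm.2 h.1
    rcases ext_eq_univ_or_of_eq_compl hne (h₁.trans h₂) with ⟨h₁, h₂⟩ | ⟨h₁, h₂⟩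
    · exact contra w (.weakIntA hp hb hd) (box_mem_of_ext_eq h₁ hA) (diam_mem_of_ext_eq h₂ hB)
    · exact contra w (.weakIntB hp hb hd) (diam_mem_of_ext_eq h₂ hB) (box_mem_of_ext_eq h₁ hA)
  · have hm := hP (Or.inr hp)
    refine fun hb hd => ⟨?_, ?_⟩
    · rintro w α ⟨A, hA, h₁⟩ ⟨B, hB, h₂⟩
      replace h₂ := compl_injective (h₂.resolve_right fun h => hm.2 h.1)
      rw [← h₁.resolve_right fun h => hm.1 h.1, canonicalModel_setNeg] at h₂
      exact contra w (.mediumIntA hp hb hd A) hA (diam_mem_of_ext_eq h₂.symm hB)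
    · rintro w α ⟨A, hA, h₁⟩ ⟨B, hB, h₂⟩
      replace h₁ := h₁.resolve_right fun h => hm.1 h.1
      rw [compl_injective (h₂.resolve_right fun h => hm.2 h.1), canonicalModel_setNeg] at h₁
      exact contra w (.mediumIntB hp hb hd B) (box_mem_of_ext_eq h₁ hA) hB
  · rintro hb hd w α β ⟨A, hA, h₁⟩ hαβ ⟨B, hB, h₂⟩
    have h : ext.{u} P A ⊆ (ext P B)ᶜ :=
      ((h₁.elim Eq.subset And.right).trans hαβ).trans (h₂.elim Eq.subset And.right)
    exact contra w (.strongInt hp hb hd A B (derivable_neg_and_of_disjoint h)) hA hB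

theorem complete (S : Set Modality) (hP : WeakNonmonotonic P) : Complete.{u} S P := by
  intro A hA
  refine derivable_of_forall_mem.{u} fun w => ?_
  exact canonicalModel_forces_iff.1 (hA _ (canonicalModel_isModelFor hP ⟨w⟩) w)

theorem weakNonmonotonic_biPrinciples (b : BiBase) (c : Bool) (n : BiUnit) :
    WeakNonmonotonic (biPrinciples b c n) := by
  cases b <;> cases n <;>
    simp [WeakNonmonotonic, biPrinciples, BiBase.principles, BiUnit.principles]

theorem weakNonmonotonic_boxPrinciples (m c n : Bool) :
    WeakNonmonotonic (boxPrinciples m c n) := by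
  simp [WeakNonmonotonic, boxPrinciples]

theorem weakNonmonotonic_diamPrinciples (m n : Bool) :
    WeakNonmonotonic (diamPrinciples m n) := by
  simp [WeakNonmonotonic, diamPrinciples]

end INNML

theorem mainTheorem1 :
    (∀ (b : INNML.BiBase) (c : Bool) (n : INNML.BiUnit),
      INNML.Sound.{u} INNML.biLang (INNML.biPrinciples b c n) ∧
      INNML.Complete.{u} INNML.biLang (INNML.biPrinciples b c n)) ∧
    (∀ m c n : Bool,
      INNML.Sound.{u} INNML.boxLang (INNML.boxPrinciples m c n) ∧
      INNML.Complete.{u} INNML.boxLang (INNML.boxPrinciples m c n)) ∧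
    (∀ m n : Bool,
      INNML.Sound.{u} INNML.diamLang (INNML.diamPrinciples m n) ∧
      INNML.Complete.{u} INNML.diamLang (INNML.diamPrinciples m n)) :=
  ⟨fun b c n => ⟨INNML.sound _ _, INNML.complete _ (INNML.weakNonmonotonic_biPrinciples b c n)⟩,
    fun m c n => ⟨INNML.sound _ _, INNML.complete _ (INNML.weakNonmonotonic_boxPrinciples m c n)⟩,
    fun m n => ⟨INNML.sound _ _, INNML.complete _ (INNML.weakNonmonotonic_diamPrinciples m n)⟩⟩
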